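/- Let $p$ be a prime, let $F$ be a field of characteristic $p$, and let $A$ be a finite-dimensional (associative, not necessarily central) division algebra over $F$. Let $F(x)$ be the field of rational functions in one variable over $F$, and write $A_E = A\otimes_F E$ for a field extension $E/F$. For a field $E$ of characteristic $p$, $\alpha\in E$ and $\beta\in E^\times$, let $$[\alpha,\beta)_{p,E}=E\langle u,y : u^p-u=\alpha,\ y^p=\beta,\ yuy^{-1}=u+1\rangle$$ be the symbol $p$-algebra. (1) Let $\gamma\in F$ and let $K=F[\wp^{-1}(\gamma)]$ be a cyclic field extension of $F$ of degree $p$ generated by a root $\theta$ of $\theta^p-\theta=\gamma$. If $A_K$ is a division algebra, then $A_{F(x)}\otimes_{F(x)}[\gamma,x)_{p,F(x)}$ is a (finite-dimensional) division algebra over $F(x)$. (2) Let $\delta\in F$ and let $L=F[\sqrt[p]{\delta}]$ be a purely inseparable field extension of $F$ of degree $p$ generated by a $p$-th root of $\delta$. If $A_L$ is a division algebra, then $A_{F(x)}\otimes_{F(x)}[x^{-1},\delta)_{p,F(x)}$ is a (finite-dimensional) division algebra over $F(x)$. -/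

import Mathlib

open scoped TensorProduct

/-- `D` is a (finite-dimensional, associative, not necessarily central) division algebra over the
field `F`. -/
structure IsDivisionAlgebra (F : Type*) (D : Type*) [Field F] [Ring D] [Algebra F D] : Prop where
  finiteDimensional : FiniteDimensional F D
  nontrivial : Nontrivial D
  isUnit_of_ne_zero : ∀ a : D, a ≠ 0 → IsUnit a

/-- The defining relations of the symbol `p`-algebra, on the free `F`-algebra on the two generators
`x = ι false` and `y = ι true`. -/
inductive SymbolRel (p : ℕ) {F : Type*} [Field F] (α β : F) :
    FreeAlgebra F Bool → FreeAlgebra F Bool → Prop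
  | artinSchreier : SymbolRel p α β
      (FreeAlgebra.ι F false ^ p - FreeAlgebra.ι F false) (algebraMap F (FreeAlgebra F Bool) α)
  | pow : SymbolRel p α β (FreeAlgebra.ι F true ^ p) (algebraMap F (FreeAlgebra F Bool) β)
  | conj : SymbolRel p α β (FreeAlgebra.ι F true * FreeAlgebra.ι F false)
      ((FreeAlgebra.ι F false + 1) * FreeAlgebra.ι F true)

/-- The symbol `p`-algebra
`[α, β)_{p,F} = F⟨x, y : x ^ p - x = α, y ^ p = β, y x y⁻¹ = x + 1⟩`, for `β ≠ 0`.
As `y` is then invertible by the second relation, the third one is written `y x = (x + 1) y`. -/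
abbrev SymbolAlgebra (p : ℕ) {F : Type*} [Field F] (α β : F) : Type _ :=
  RingQuot (SymbolRel p α β)

/-- `K = F[℘⁻¹(γ)]` is a cyclic field extension of `F` of degree `p`. -/
structure IsCyclicArtinSchreier (p : ℕ) {F : Type*} [Field F] (γ : F) (K : Type*) [Field K]
    [Algebra F K] : Prop where
  isGalois : IsGalois F K
  isCyclic : IsCyclic (K ≃ₐ[F] K)
  finrank_eq : Module.finrank F K = p
  exists_generator : ∃ θ : K, θ ^ p - θ = algebraMap F K γ ∧ IntermediateField.adjoin F {θ} = ⊤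

/-- `L = F[δ^{1/p}]` is a purely inseparable field extension of `F` of degree `p`. -/
structure IsPurelyInseparableRoot (p : ℕ) {F : Type*} [Field F] (δ : F) (L : Type*) [Field L]
    [Algebra F L] : Prop where
  isPurelyInseparable : IsPurelyInseparable F L
  finrank_eq : Module.finrank F L = p
  exists_generator : ∃ θ : L, θ ^ p = algebraMap F L δ ∧ IntermediateField.adjoin F {θ} = ⊤

/-! Put `E = F(x)`, let `S` be the symbol algebra and `B = A_E ⊗ S`. One generator of `S` generates
an image of `K` (resp. `L`), hence gives a map to `B` from the division algebra `D = K ⊗ A` (resp.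
`L ⊗ A`). The other generator `z` satisfies `zD ⊆ Dz + D`, so the sums `∑ dᵢ zⁱ` form a subalgebra
`R`, an image of an Ore extension of `D`. Moreover `t = x = y ^ p` (resp. `t = x⁻¹ = u ^ p - u`)
lies in `F[z]`, so `F[t] ⊆ R`, and `B` is `R` with the nonzero elements of `F[t]` inverted.

Let `0 ≠ b ∈ R`. Its leading coefficient is invertible in `D`, so division with remainder shows that
the image of `R` in `B / Bb` is finite-dimensional over `F`. Powers of `t` are then dependent modulo
`Bb`, so `Bb` contains some `f(t)` with `f ≠ 0`, a unit of `E`. Thus `b` is left invertible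
(`IsOreVariable.exists_aeval_mem_span`, `isDivisionAlgebra_of_isOreVariable`).

The powers of `z` need not be independent over `D`: of `S` only finiteness and `S ≠ 0` are needed,
not its dimension. -/

/-! ### Images of Ore extensions and division with remainder -/

section PowSpan

variable {F D B : Type*} [Field F] [Ring D] [Algebra F D] [Ring B] [Algebra F B]

/-- The left `D`-span of `1, z, …, z ^ (n - 1)`, as an `F`-subspace. -/
def powSpan (φ : D →ₐ[F] B) (z : B) : ℕ → Submodule F B
  | 0 => ⊥
  | n + 1 => powSpan φ z n ⊔
      LinearMap.range ((LinearMap.mulRight F (z ^ n)).comp φ.toLinearMap)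

theorem mem_powSpan_succ {φ : D →ₐ[F] B} {z : B} {n : ℕ} {b : B} :
    b ∈ powSpan φ z (n + 1) ↔ ∃ l ∈ powSpan φ z n, ∃ d, l + φ d * z ^ n = b := by
  simp [powSpan, Submodule.mem_sup]

theorem powSpan_mono (φ : D →ₐ[F] B) (z : B) : Monotone (powSpan φ z) :=
  monotone_nat_of_le_succ fun _ => le_sup_left

theorem map_mul_pow_mem_powSpan (φ : D →ₐ[F] B) (z : B) (d : D) {i n : ℕ} (h : i < n) :
    φ d * z ^ i ∈ powSpan φ z n :=
  powSpan_mono φ z h (mem_powSpan_succ.2 ⟨0, zero_mem _, d, zero_add _⟩)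

instance finite_powSpan [Module.Finite F D] (φ : D →ₐ[F] B) (z : B) (n : ℕ) :
    Module.Finite F (powSpan φ z n) := by
  induction n with
  | zero => exact inferInstanceAs (Module.Finite F (⊥ : Submodule F B))
  | succ n ih => exact Submodule.finite_sup _ _

theorem map_mul_mem_powSpan {φ : D →ₐ[F] B} {z : B} (d : D) {n : ℕ} {b : B}
    (hb : b ∈ powSpan φ z n) : φ d * b ∈ powSpan φ z n := by
  induction n generalizing b with
  | zero => simp_all [powSpan]
  | succ n ih =>
    obtain ⟨l, hl, e, rfl⟩ := mem_powSpan_succ.1 hb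
    exact mem_powSpan_succ.2 ⟨_, ih hl, d * e, by simp [mul_add, mul_assoc]⟩

/-- `z` is normalized by `D` up to lower order terms, as the variable of an Ore extension is. -/
def IsOreVariable (φ : D →ₐ[F] B) (z : B) : Prop :=
  ∀ d, ∃ d₁ d₀, z * φ d = φ d₁ * z + φ d₀

variable {φ : D →ₐ[F] B} {z : B}

theorem IsOreVariable.mul_mem_powSpan (hz : IsOreVariable φ z) {n : ℕ} {b : B}
    (hb : b ∈ powSpan φ z n) : z * b ∈ powSpan φ z (n + 1) := by
  induction n generalizing b with
  | zero => simp_all [powSpan]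
  | succ n ih =>
    obtain ⟨l, hl, d, rfl⟩ := mem_powSpan_succ.1 hb
    obtain ⟨d₁, d₀, h⟩ := hz d
    have : z * (l + φ d * z ^ n) = z * l + (φ d₁ * z ^ (n + 1) + φ d₀ * z ^ n) := by
      rw [mul_add, ← mul_assoc, h, add_mul, mul_assoc, pow_succ']
    rw [this]
    exact add_mem (powSpan_mono φ z (n + 1).le_succ (ih hl))
      (add_mem (map_mul_pow_mem_powSpan _ _ _ (by omega)) (map_mul_pow_mem_powSpan _ _ _ (by omega)))

theorem IsOreVariable.pow_mul_mem_powSpan (hz : IsOreVariable φ z) {n : ℕ} {b : B}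
    (hb : b ∈ powSpan φ z n) (m : ℕ) : z ^ m * b ∈ powSpan φ z (n + m) := by
  induction m with
  | zero => simpa
  | succ m ih => rw [pow_succ', mul_assoc]; exact hz.mul_mem_powSpan ih

theorem IsOreVariable.mul_mem_powSpan_add (hz : IsOreVariable φ z) {m n : ℕ} {b c : B}
    (hb : b ∈ powSpan φ z m) (hc : c ∈ powSpan φ z n) : b * c ∈ powSpan φ z (n + m) := by
  induction m generalizing b with
  | zero => simp_all [powSpan]
  | succ m ih =>
    obtain ⟨l, hl, d, rfl⟩ := mem_powSpan_succ.1 hb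
    rw [add_mul, mul_assoc]
    exact powSpan_mono φ z (n + m).le_succ
      (add_mem (ih hl) (map_mul_mem_powSpan d (hz.pow_mul_mem_powSpan hc m)))

/-- The union of the `powSpan φ z n`. -/
def IsOreVariable.subalgebra (hz : IsOreVariable φ z) : Subalgebra F B where
  carrier := {b | ∃ n, b ∈ powSpan φ z n}
  mul_mem' := fun ⟨_, hb⟩ ⟨_, hc⟩ => ⟨_, hz.mul_mem_powSpan_add hb hc⟩
  add_mem' := fun ⟨m, hb⟩ ⟨n, hc⟩ => ⟨max m n,
    add_mem (powSpan_mono φ z (le_max_left _ _) hb) (powSpan_mono φ z (le_max_right _ _) hc)⟩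
  algebraMap_mem' := fun r => ⟨1, by
    simpa using map_mul_pow_mem_powSpan φ z (algebraMap F D r) (i := 0) one_pos⟩

theorem IsOreVariable.map_mem (hz : IsOreVariable φ z) (d : D) : φ d ∈ hz.subalgebra :=
  ⟨1, by simpa using map_mul_pow_mem_powSpan φ z d (i := 0) one_pos⟩

theorem IsOreVariable.self_mem (hz : IsOreVariable φ z) : z ∈ hz.subalgebra :=
  -- Stage `n` holds the degrees below `n`, so `z` appears at stage 2.
  ⟨2, by simpa using map_mul_pow_mem_powSpan φ z 1 (i := 1) one_lt_two⟩

/-- The elements satisfying the Ore condition are closed under products, so that it can be checked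
on generators. -/
theorem isOreVariable_of_adjoin_eq_top {s : Set D} (hs : Algebra.adjoin F s = ⊤)
    (h : ∀ d ∈ s, ∃ d₁ d₀, z * φ d = φ d₁ * z + φ d₀) : IsOreVariable φ z := by
  intro d
  have hd : d ∈ Algebra.adjoin F s := hs ▸ Algebra.mem_top
  induction hd using Algebra.adjoin_induction with
  | mem x hx => exact h x hx
  | algebraMap r => exact ⟨algebraMap F D r, 0, by simp [Algebra.commutes]⟩
  | add x y _ _ hx hy =>
    obtain ⟨x₁, x₀, hx⟩ := hx
    obtain ⟨y₁, y₀, hy⟩ := hy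
    exact ⟨x₁ + y₁, x₀ + y₀, by simp only [map_add, mul_add, hx, hy, add_mul]; abel⟩
  | mul x y _ _ hx hy =>
    obtain ⟨x₁, x₀, hx⟩ := hx
    obtain ⟨y₁, y₀, hy⟩ := hy
    refine ⟨x₁ * y₁, x₁ * y₀ + x₀ * y, ?_⟩
    rw [map_mul, ← mul_assoc, hx, add_mul, mul_assoc, hy]
    simp [mul_add, mul_assoc, add_assoc]

/-- Division with remainder by an element with invertible leading coefficient. -/
theorem IsOreVariable.powSpan_le_sup_span (hz : IsOreVariable φ z) {N : ℕ} {l : B}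
    (hl : l ∈ powSpan φ z N) (n : ℕ) :
    powSpan φ z n ≤
      powSpan φ z N ⊔ (Submodule.span B {l + z ^ N}).restrictScalars F := by
  set S := powSpan φ z N ⊔ (Submodule.span B {l + z ^ N}).restrictScalars F with hS
  -- `S` is stable under `D` and `z` and contains `z ^ N`, hence every `z ^ n`. Under `z`, the only
  -- overflow from the remainders is a term `d z ^ N`, where `z ^ N ≡ -l`.
  have hD : ∀ d, ∀ b ∈ S, φ d * b ∈ S := fun d b hb => by
    obtain ⟨x, hx, y, hy, rfl⟩ := Submodule.mem_sup.1 hb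
    rw [mul_add]
    exact Submodule.mem_sup.2 ⟨_, map_mul_mem_powSpan d hx, _,
      Submodule.smul_mem (Submodule.span B {l + z ^ N}) (φ d) hy, rfl⟩
  have hN : z ^ N ∈ S := Submodule.mem_sup.2
    ⟨-l, neg_mem hl, l + z ^ N, Submodule.mem_span_singleton_self _, by abel⟩
  have hzS : ∀ b ∈ S, z * b ∈ S := fun b hb => by
    obtain ⟨x, hx, y, hy, rfl⟩ := Submodule.mem_sup.1 hb
    rw [mul_add]
    refine add_mem ?_ (Submodule.mem_sup_right
      (Submodule.smul_mem (Submodule.span B {l + z ^ N}) z hy))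
    obtain ⟨m, hm, d, e⟩ := mem_powSpan_succ.1 (hz.mul_mem_powSpan hx)
    rw [← e]
    exact add_mem (Submodule.mem_sup_left hm) (hD d _ hN)
  have hpow : ∀ n, z ^ n ∈ S := fun n => by
    rcases lt_or_ge n N with h | h
    · exact Submodule.mem_sup_left (by simpa using map_mul_pow_mem_powSpan φ z 1 h)
    · induction n, h using Nat.le_induction with
      | base => exact hN
      | succ n _ ih => rw [pow_succ']; exact hzS _ ih
  induction n with
  | zero => exact bot_le
  | succ n ih =>
    intro b hb
    obtain ⟨l, hl, d, rfl⟩ := mem_powSpan_succ.1 hb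
    exact add_mem (ih hl) (hD d _ (hpow n))

/-- If `D` is a division ring, every nonzero left ideal generated by an element of the Ore
subalgebra contains a nonzero polynomial in `t`. -/
theorem IsOreVariable.exists_aeval_mem_span [Module.Finite F D] (hz : IsOreVariable φ z)
    (hD : ∀ d : D, d ≠ 0 → IsUnit d) {t : B} (ht : t ∈ hz.subalgebra) {b : B}
    (hb : b ∈ hz.subalgebra) (hb0 : b ≠ 0) :
    ∃ f : Polynomial F, f ≠ 0 ∧ Polynomial.aeval t f ∈ Submodule.span B {b} := by
  obtain ⟨n, hb⟩ := hb
  induction n with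
  | zero => simp_all [powSpan]
  | succ N ih =>
    obtain ⟨l, hl, d, e⟩ := mem_powSpan_succ.1 hb
    by_cases hd : d = 0
    · exact ih (by simpa [← e, hd] using hl)
    obtain ⟨c, hc⟩ := (hD d hd).exists_left_inv
    have hcb : φ c * b = φ c * l + z ^ N := by
      rw [← e, mul_add, ← mul_assoc, ← map_mul, hc, map_one, one_mul]
    have hle := hz.powSpan_le_sup_span (map_mul_mem_powSpan c hl)
    rw [← hcb] at hle
    set I := Submodule.span B {φ c * b}
    have hI : I ≤ Submodule.span B {b} :=
      (Submodule.span_singleton_le_iff_mem _ _).2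
        (Submodule.smul_mem _ (φ c) (Submodule.mem_span_singleton_self b))
    let π : B →ₗ[F] B ⧸ I := (I.mkQ).restrictScalars F
    let W := (powSpan φ z N).map π
    -- Every `f(t)` has a remainder of degree below `N` modulo `I`, so `F[X]` maps to the
    -- finite-dimensional `W`, and the map has a kernel.
    have hW : ∀ f : Polynomial F, π (Polynomial.aeval t f) ∈ W := fun f => by
      have hf : Polynomial.aeval t f ∈ hz.subalgebra :=
        Algebra.adjoin_le (Set.singleton_subset_iff.2 ht)
          (Polynomial.aeval_mem_adjoin_singleton F t)
      obtain ⟨n, hn⟩ := hf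
      obtain ⟨x, hx, y, hy, e⟩ := Submodule.mem_sup.1 (hle n hn)
      have hy0 : π y = 0 := (Submodule.Quotient.mk_eq_zero I).2 hy
      rw [← e, map_add, hy0, add_zero]
      exact Submodule.mem_map_of_mem hx
    let g : Polynomial F →ₗ[F] W :=
      (π.comp (Polynomial.aeval t).toLinearMap).codRestrict W hW
    have hg : ¬ Function.Injective g := fun h => by
      have : Module.Finite F (Polynomial F) := Module.Finite.of_injective g h
      exact Polynomial.not_finite this
    rw [← LinearMap.ker_eq_bot, Submodule.eq_bot_iff] at hg
    push Not at hg
    obtain ⟨f, hf, hf0⟩ := hg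
    exact ⟨f, hf0, hI ((Submodule.Quotient.mk_eq_zero I).1 (congrArg Subtype.val hf))⟩

end PowSpan

/-! ### Central localization -/

/-- A left inverse `c` of `b` has a left inverse in turn, which must be `b`. -/
theorem isUnit_of_forall_exists_left_inv {B : Type*} [Ring B] [Nontrivial B]
    (h : ∀ b : B, b ≠ 0 → ∃ c, c * b = 1) (b : B) (hb : b ≠ 0) : IsUnit b := by
  obtain ⟨c, hc⟩ := h b hb
  obtain ⟨d, hd⟩ := h c (by rintro rfl; simp at hc)
  have : d = b := by rw [← mul_one d, ← hc, ← mul_assoc, hd, one_mul]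
  exact ⟨⟨b, c, this ▸ hd, hc⟩, rfl⟩

open scoped IntermediateField in
/-- A central localization of an Ore extension of a finite-dimensional division algebra is a
division algebra. -/
theorem isDivisionAlgebra_of_isOreVariable {F E D B : Type*} [Field F] [Field E] [Algebra F E]
    [Ring D] [Algebra F D] [Module.Finite F D] [Ring B] [Nontrivial B] [Algebra F B] [Algebra E B]
    [IsScalarTower F E B] [Module.Finite E B] {φ : D →ₐ[F] B} {z : B} (hz : IsOreVariable φ z)
    (hD : ∀ d : D, d ≠ 0 → IsUnit d) {t : E} (ht : Transcendental F t) (htop : F⟮t⟯ = ⊤)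
    (htz : algebraMap E B t ∈ hz.subalgebra)
    (hspan : Algebra.adjoin E (insert z (Set.range φ)) = ⊤) : IsDivisionAlgebra E B := by
  refine ⟨inferInstance, inferInstance, isUnit_of_forall_exists_left_inv fun b hb => ?_⟩
  have key : ∀ f : Polynomial F, Polynomial.aeval (algebraMap E B t) f
      = algebraMap E B (Polynomial.aeval t f) := fun f => Polynomial.aeval_algebraMap_apply B t f
  have hne : ∀ f : Polynomial F, f ≠ 0 → Polynomial.aeval t f ≠ 0 := fun f hf h =>
    hf ((transcendental_iff.1 ht) f h)
  have hmem : ∀ f : Polynomial F, algebraMap E B (Polynomial.aeval t f) ∈ hz.subalgebra :=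
    fun f => key f ▸ Algebra.adjoin_le (Set.singleton_subset_iff.2 htz)
      (Polynomial.aeval_mem_adjoin_singleton F _)
  -- Denominators from `F[t]` can be cleared: they are central, so those of two factors or summands
  -- multiply.
  have hloc : ∀ b : B, ∃ f : Polynomial F, f ≠ 0 ∧
      algebraMap E B (Polynomial.aeval t f) * b ∈ hz.subalgebra := fun b => by
    have hb : b ∈ Algebra.adjoin E (insert z (Set.range φ)) := hspan ▸ Algebra.mem_top
    induction hb using Algebra.adjoin_induction with
    | mem x hx =>
      refine ⟨1, one_ne_zero, ?_⟩
      rcases hx with rfl | ⟨d, rfl⟩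
      · simpa using hz.self_mem
      · simpa using hz.map_mem d
    | algebraMap r =>
      have hr : r ∈ F⟮t⟯ := htop ▸ IntermediateField.mem_top
      obtain ⟨g, f, rfl⟩ := (IntermediateField.mem_adjoin_simple_iff F r).1 hr
      by_cases hf : f = 0
      · exact ⟨1, one_ne_zero, by simp [hf]⟩
      · refine ⟨f, hf, ?_⟩
        rw [← map_mul, mul_div_cancel₀ _ (hne f hf)]
        exact hmem g
    | add x y _ _ hx hy =>
      obtain ⟨f, hf, hx⟩ := hx
      obtain ⟨g, hg, hy⟩ := hy
      refine ⟨f * g, mul_ne_zero hf hg, ?_⟩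
      have : algebraMap E B (Polynomial.aeval t (f * g)) * (x + y)
          = algebraMap E B (Polynomial.aeval t g) * (algebraMap E B (Polynomial.aeval t f) * x)
          + algebraMap E B (Polynomial.aeval t f) * (algebraMap E B (Polynomial.aeval t g) * y) := by
        simp only [map_mul, mul_add, mul_assoc]
        rw [← mul_assoc _ _ x, ← map_mul, mul_comm, map_mul, mul_assoc]
      rw [this]
      exact add_mem (mul_mem (hmem _) hx) (mul_mem (hmem _) hy)
    | mul x y _ _ hx hy =>
      obtain ⟨f, hf, hx⟩ := hx
      obtain ⟨g, hg, hy⟩ := hy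
      refine ⟨f * g, mul_ne_zero hf hg, ?_⟩
      have : algebraMap E B (Polynomial.aeval t (f * g)) * (x * y)
          = (algebraMap E B (Polynomial.aeval t f) * x)
          * (algebraMap E B (Polynomial.aeval t g) * y) := by
        rw [map_mul, map_mul, mul_assoc, mul_assoc, ← mul_assoc x, ← Algebra.commutes _ x,
          mul_assoc]
      rw [this]
      exact mul_mem hx hy
  have hunit : ∀ f : Polynomial F, f ≠ 0 → IsUnit (algebraMap E B (Polynomial.aeval t f)) :=
    fun f hf => (isUnit_iff_ne_zero.2 (hne f hf)).map _
  obtain ⟨f, hf, hfb⟩ := hloc b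
  obtain ⟨g, hg, hgb⟩ := hz.exists_aeval_mem_span hD htz hfb
    (fun h => hb ((hunit f hf).mul_right_eq_zero.1 h))
  obtain ⟨c, hc⟩ := Submodule.mem_span_singleton.1 hgb
  obtain ⟨e, he⟩ := (hunit g hg).exists_left_inv
  refine ⟨e * (c * algebraMap E B (Polynomial.aeval t f)), ?_⟩
  rw [mul_assoc, mul_assoc c, ← he, ← key g, ← hc, smul_eq_mul]

/-! ### Simple extensions presented by a polynomial -/

section ArtinSchreier

open Polynomial

theorem natDegree_X_pow_sub_X_sub_C {F : Type*} [Field F] {p : ℕ} (hp : 1 < p) (a : F) :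
    (X ^ p - X - C a : F[X]).natDegree = p := by
  rw [natDegree_sub_C, FiniteField.X_pow_card_sub_X_natDegree_eq F hp]

theorem monic_X_pow_sub_X_sub_C {F : Type*} [Field F] {p : ℕ} (hp : 1 < p) (a : F) :
    (X ^ p - X - C a : F[X]).Monic := by
  rw [sub_sub]
  refine monic_X_pow_sub ?_
  rw [degree_X_add_C]
  exact_mod_cast hp

/-- A monic polynomial of degree `[K : F]` presents the simple extension `K` generated by one of
its roots. -/
theorem exists_algHom_apply_eq_of_natDegree_eq_finrank {F K S : Type*} [Field F] [Field K]
    [Algebra F K] [FiniteDimensional F K] [Ring S] [Algebra F S] {g : F[X]} (hg : g.Monic)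
    (hdeg : g.natDegree = Module.finrank F K) {θ : K} (hθ : aeval θ g = 0)
    (htop : IntermediateField.adjoin F {θ} = ⊤) {w : S} (hw : aeval w g = 0) :
    Algebra.adjoin F {θ} = ⊤ ∧ ∃ ψ : K →ₐ[F] S, ψ θ = w := by
  have hint : IsIntegral F θ := .of_finite F θ
  have hadj : Algebra.adjoin F {θ} = ⊤ := by
    rw [← IntermediateField.adjoin_simple_toSubalgebra_of_isAlgebraic hint.isAlgebraic, htop,
      IntermediateField.top_toSubalgebra]
  have hmin : minpoly F θ = g :=
    (eq_of_monic_of_dvd_of_natDegree_le (minpoly.monic hint) hg (minpoly.dvd F θ hθ) (by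
      rw [hdeg, (Field.primitive_element_iff_minpoly_natDegree_eq F θ).1 htop])).symm
  let pb := PowerBasis.ofAdjoinEqTop hint hadj
  have hgen : pb.gen = θ := PowerBasis.ofAdjoinEqTop_gen hint hadj
  have hw' : aeval w (minpoly F pb.gen) = 0 := by rw [hgen, hmin, hw]
  exact ⟨hadj, pb.lift w hw', (congrArg (pb.lift w hw') hgen.symm).trans (pb.lift_gen w hw')⟩

end ArtinSchreier

/-! ### Finiteness and nontriviality of symbol algebras -/

/-- `E[u]` is finite because `u` is integral, `y` is an Ore variable over it, and `y ^ p` is a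
scalar, so degrees below `p` in `y` suffice. -/
theorem finite_of_symbol_relations {p : ℕ} (hp : 1 < p) {E S : Type*} [Field E] [Ring S]
    [Algebra E S] {α β : E} {u y : S} (hu : u ^ p - u = algebraMap E S α)
    (hy : y ^ p = algebraMap E S β) (hyu : y * u = (u + 1) * y)
    (hadj : Algebra.adjoin E {u, y} = ⊤) : Module.Finite E S := by
  have hint : IsIntegral E (u) :=
    ⟨_, monic_X_pow_sub_X_sub_C hp α, by
      rw [← Polynomial.aeval_def]
      simp [hu]⟩
  have hfin : Module.Finite E (Algebra.adjoin E {u}) := .of_fg hint.fg_adjoin_singleton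
  let φ := (Algebra.adjoin E {u}).val
  have hz :=
    isOreVariable_of_adjoin_eq_top (φ := φ) (z := y) (Algebra.adjoin_adjoin_coe_preimage (R := E))
      fun d (hd : φ d = u) =>
        ⟨d + 1, 0, by rw [map_add, map_one, hd, hyu, map_zero, add_zero]⟩
  have hle : ∀ n, powSpan φ y n ≤ powSpan φ y p := fun n => by
    induction n with
    | zero => exact bot_le
    | succ n ih =>
      intro b hb
      obtain ⟨l, hl, d, rfl⟩ := mem_powSpan_succ.1 hb
      refine add_mem (ih hl) ?_
      have : φ d * y ^ n = φ (d * algebraMap E _ (β ^ (n / p))) * y ^ (n % p) := by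
        conv_lhs => rw [← Nat.div_add_mod n p, pow_add, pow_mul, hy]
        rw [map_mul, AlgHom.commutes, map_pow, mul_assoc]
      rw [this]
      exact map_mul_pow_mem_powSpan _ _ _ (Nat.mod_lt _ (by omega))
  have htop : hz.subalgebra = ⊤ := by
    rw [eq_top_iff, ← hadj, Algebra.adjoin_le_iff]
    rintro x (rfl | rfl)
    · exact hz.map_mem ⟨_, Algebra.subset_adjoin rfl⟩
    · exact hz.self_mem
  refine Module.Finite.of_surjective (powSpan φ y p).subtype fun b => ?_
  obtain ⟨n, hn⟩ : b ∈ hz.subalgebra := htop ▸ Algebra.mem_top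
  exact ⟨⟨b, hle n hn⟩, rfl⟩

namespace SymbolAlgebra

variable (p : ℕ) {E : Type*} [Field E] (α β : E)

/-- The Artin–Schreier generator. -/
noncomputable def u : SymbolAlgebra p α β :=
  RingQuot.mkAlgHom E (SymbolRel p α β) (FreeAlgebra.ι E false)

/-- The Kummer type generator. -/
noncomputable def y : SymbolAlgebra p α β :=
  RingQuot.mkAlgHom E (SymbolRel p α β) (FreeAlgebra.ι E true)

theorem u_pow_sub_u : u p α β ^ p - u p α β = algebraMap E _ α := by
  simpa [u] using RingQuot.mkAlgHom_rel E (SymbolRel.artinSchreier (p := p) (α := α) (β := β))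

theorem y_pow : y p α β ^ p = algebraMap E _ β := by
  simpa [y] using RingQuot.mkAlgHom_rel E (SymbolRel.pow (p := p) (α := α) (β := β))

theorem y_mul_u : y p α β * u p α β = (u p α β + 1) * y p α β := by
  simpa [u, y] using RingQuot.mkAlgHom_rel E (SymbolRel.conj (p := p) (α := α) (β := β))

theorem adjoin_u_y : Algebra.adjoin E {u p α β, y p α β} = ⊤ := by
  have h := congrArg (Subalgebra.map (RingQuot.mkAlgHom E (SymbolRel p α β)))
    (FreeAlgebra.adjoin_range_ι E Bool)
  rw [AlgHom.map_adjoin, Algebra.map_top,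
    AlgHom.range_eq_top _ |>.2 (RingQuot.mkAlgHom_surjective E _), ← Set.range_comp] at h
  rw [← h, Bool.range_eq]
  rfl

theorem finite (hp : 1 < p) : Module.Finite E (SymbolAlgebra p α β) :=
  finite_of_symbol_relations hp (u_pow_sub_u p α β) (y_pow p α β) (y_mul_u p α β)
    (adjoin_u_y p α β)

/-- The representation on functions `ZMod p → C`, for an algebraic closure `C` of `E`. -/
theorem nontrivial [Fact p.Prime] [CharP E p] : Nontrivial (SymbolAlgebra p α β) := by
  let C := AlgebraicClosure E
  have hp := (Fact.out : p.Prime)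
  have : CharP C p := charP_of_injective_algebraMap (algebraMap E C).injective p
  obtain ⟨η, hη⟩ := IsAlgClosed.exists_pow_nat_eq (algebraMap E C β) hp.pos
  obtain ⟨θ, hθ⟩ := IsAlgClosed.exists_root
    (Polynomial.X ^ p - Polynomial.X - Polynomial.C (algebraMap E C α)) (by
      rw [Polynomial.degree_eq_natDegree (monic_X_pow_sub_X_sub_C hp.one_lt _).ne_zero,
        natDegree_X_pow_sub_X_sub_C hp.one_lt]
      exact_mod_cast hp.ne_zero)
  have hθ : θ ^ p - θ = algebraMap E C α := by
    simpa [sub_eq_zero] using hθ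
  -- The roots of the Artin–Schreier polynomial are the translates `θ + i`. `U` is diagonal with
  -- these entries; `Y` is `η` times the cyclic shift, whose `p`-th power is the scalar `η ^ p = β`.
  let c : ZMod p → C := fun i => θ + ZMod.castHom dvd_rfl C i
  have hc : ∀ i, c i ^ p - c i = algebraMap E C α := fun i => by
    simp only [c]
    rw [add_pow_char, ← map_pow, ZMod.pow_card, ← hθ]
    abel
  let U : Module.End E (ZMod p → C) :=
    { toFun := fun v i => c i * v i
      map_add' := fun v w => funext fun i => mul_add _ _ _
      map_smul' := fun r v => funext fun i => by simp }
  let Y : Module.End E (ZMod p → C) :=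
    { toFun := fun v i => η * v (i + 1)
      map_add' := fun v w => funext fun i => mul_add _ _ _
      map_smul' := fun r v => funext fun i => by simp }
  have hU : ∀ n v i, (U ^ n) v i = c i ^ n * v i := fun n => by
    induction n with
    | zero => simp
    | succ n ih =>
      intro v i
      rw [pow_succ', Module.End.mul_apply, pow_succ', mul_assoc, ← ih]
      rfl
  have hY : ∀ (n : ℕ) v i, (Y ^ n) v i = η ^ n * v (i + n) := fun n => by
    induction n with
    | zero => simp
    | succ n ih =>
      intro v i
      rw [pow_succ', Module.End.mul_apply, pow_succ', mul_assoc, Nat.cast_succ, add_comm (n : ZMod p),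
        ← add_assoc, ← ih]
      rfl
  let f : FreeAlgebra E Bool →ₐ[E] Module.End E (ZMod p → C) :=
    FreeAlgebra.lift E fun b => bif b then Y else U
  have hf : f (FreeAlgebra.ι E false) = U := by simp [f]
  have ht : f (FreeAlgebra.ι E true) = Y := by simp [f]
  have hrel : ∀ ⦃a b⦄, SymbolRel p α β a b → f a = f b := by
    rintro _ _ (_ | _ | _)
    · rw [map_sub, map_pow, hf, AlgHom.commutes]
      refine LinearMap.ext fun v => funext fun i => ?_
      change (U ^ p) v i - U v i = (algebraMap E (Module.End E (ZMod p → C)) α) v i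
      rw [hU, Module.algebraMap_end_apply, Pi.smul_apply, Algebra.smul_def, ← hc i, sub_mul]
      rfl
    · rw [map_pow, ht, AlgHom.commutes]
      refine LinearMap.ext fun v => funext fun i => ?_
      rw [hY, Module.algebraMap_end_apply, Pi.smul_apply, Algebra.smul_def, hη]
      simp
    · rw [map_mul, map_mul, map_add, map_one, ht, hf]
      refine LinearMap.ext fun v => funext fun i => ?_
      change η * ((θ + ZMod.castHom dvd_rfl C (i + 1)) * v (i + 1))
        = (θ + ZMod.castHom dvd_rfl C i) * (η * v (i + 1)) + η * v (i + 1)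
      rw [map_add, map_one]
      ring
  exact (RingQuot.liftAlgHom E ⟨f, hrel⟩).toRingHom.domain_nontrivial

end SymbolAlgebra

/-! ### The tensor product with `A` and the main theorem -/

theorem Subalgebra.eq_top_of_tmul_mem {R P Q : Type*} [CommRing R] [Ring P] [Ring Q] [Algebra R P]
    [Algebra R Q] (S : Subalgebra R (P ⊗[R] Q)) (hP : ∀ a : P, a ⊗ₜ[R] (1 : Q) ∈ S)
    (hQ : ∀ b : Q, (1 : P) ⊗ₜ[R] b ∈ S) : S = ⊤ := by
  rw [eq_top_iff]
  intro x _
  induction x using TensorProduct.induction_on with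
  | zero => exact zero_mem S
  | tmul a b => simpa using mul_mem (hP a) (hQ b)
  | add x y hx hy => exact add_mem (hx trivial) (hy trivial)

open scoped IntermediateField in
/-- If `S` is generated over `E = F(t)` by the image of `K` and an Ore variable `z` over `K` with
`t ∈ F[z]`, then `A_E ⊗ S` is a division algebra as soon as `A_K` is one. -/
theorem isDivisionAlgebra_tensorProduct {F E K A S : Type*} [Field F] [Field E] [Algebra F E]
    [Field K] [Algebra F K] [FiniteDimensional F K] [Ring A] [Algebra F A]
    (hA : IsDivisionAlgebra F A) (hKA : IsDivisionAlgebra K (K ⊗[F] A)) [Ring S] [Algebra E S]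
    [Algebra F S] [IsScalarTower F E S] [Module.Finite E S] [Nontrivial S] (ψ : K →ₐ[F] S) (z : S)
    {θ : K} (hθ : Algebra.adjoin F {θ} = ⊤) (hS : Algebra.adjoin E {ψ θ, z} = ⊤)
    (hz : ∃ k₁ k₀ : K, z * ψ θ = ψ k₁ * z + ψ k₀) {t : E} (ht : Transcendental F t)
    (htop : F⟮t⟯ = ⊤) (htz : algebraMap E S t ∈ Algebra.adjoin F {z}) :
    IsDivisionAlgebra E ((E ⊗[F] A) ⊗[E] S) := by
  have := hA.finiteDimensional
  have := hA.nontrivial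
  have := hKA.finiteDimensional
  let B := (E ⊗[F] A) ⊗[E] S
  let ι : S →ₐ[E] B := Algebra.TensorProduct.includeRight
  let j : A →ₐ[F] B := ((Algebra.TensorProduct.includeLeft :
    (E ⊗[F] A) →ₐ[E] B).restrictScalars F).comp Algebra.TensorProduct.includeRight
  have hcomm : ∀ s a, Commute (ι s) (j a) := fun s a => by
    change (1 : E ⊗[F] A) ⊗ₜ[E] s * ((1 : E) ⊗ₜ[F] a) ⊗ₜ[E] (1 : S) =
      ((1 : E) ⊗ₜ[F] a) ⊗ₜ[E] (1 : S) * (1 : E ⊗[F] A) ⊗ₜ[E] s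
    simp
  let φ : K ⊗[F] A →ₐ[F] B :=
    Algebra.TensorProduct.lift ((ι.restrictScalars F).comp ψ) j fun k a => hcomm (ψ k) a
  have hφK : ∀ k, φ (k ⊗ₜ 1) = ι (ψ k) := fun k =>
    (Algebra.TensorProduct.lift_tmul _ _ _ _ _).trans (by rw [map_one, mul_one]; rfl)
  have hφA : ∀ a, φ (1 ⊗ₜ a) = j a := fun a =>
    (Algebra.TensorProduct.lift_tmul _ _ _ _ _).trans (by rw [map_one, one_mul])
  have : Module.Finite F (K ⊗[F] A) := Module.Finite.trans K _
  -- On generators: `A` commutes with `z`, so only `θ` needs the hypothesis `hz`.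
  have hore : IsOreVariable φ (ι z) := by
    have hgen : Algebra.adjoin F (insert (θ ⊗ₜ[F] (1 : A))
        (Set.range fun a : A => (1 : K) ⊗ₜ[F] a)) = ⊤ := by
      refine Subalgebra.eq_top_of_tmul_mem _ (fun k => ?_)
        fun a => Algebra.subset_adjoin (Set.mem_insert_of_mem _ ⟨a, rfl⟩)
      have hk : k ∈ Algebra.adjoin F {θ} := hθ ▸ Algebra.mem_top
      have hle : Algebra.adjoin F {θ} ≤ Subalgebra.comap
          (Algebra.TensorProduct.includeLeft : K →ₐ[F] K ⊗[F] A)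
          (Algebra.adjoin F (insert (θ ⊗ₜ[F] (1 : A)) (Set.range fun a : A => (1 : K) ⊗ₜ[F] a))) :=
        Algebra.adjoin_le (Set.singleton_subset_iff.2
          (Algebra.subset_adjoin (Set.mem_insert _ _)))
      exact hle hk
    refine isOreVariable_of_adjoin_eq_top hgen ?_
    rintro d (rfl | ⟨a, rfl⟩)
    · obtain ⟨k₁, k₀, h⟩ := hz
      refine ⟨k₁ ⊗ₜ 1, k₀ ⊗ₜ 1, ?_⟩
      rw [hφK, hφK, hφK, ← map_mul, h, map_add, map_mul]
    · refine ⟨1 ⊗ₜ a, 0, ?_⟩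
      rw [hφA, map_zero, add_zero]
      exact hcomm z a
  have : Nontrivial (E ⊗[F] A) := inferInstance
  have : Nontrivial B := inferInstanceAs (Nontrivial ((E ⊗[F] A) ⊗[E] S))
  have : Module.Finite E B := inferInstanceAs (Module.Finite E ((E ⊗[F] A) ⊗[E] S))
  refine isDivisionAlgebra_of_isOreVariable (B := B) hore hKA.isUnit_of_ne_zero ht htop ?_ ?_
  · have hle : Algebra.adjoin F {z} ≤ hore.subalgebra.comap (ι.restrictScalars F) :=
      Algebra.adjoin_le (Set.singleton_subset_iff.2 hore.self_mem)
    have := hle htz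
    rw [← ι.commutes]
    exact this
  · have hmem : ∀ k, φ k ∈ Algebra.adjoin E (insert (ι z) (Set.range φ)) := fun k =>
      Algebra.subset_adjoin (Set.mem_insert_of_mem _ ⟨k, rfl⟩)
    refine Subalgebra.eq_top_of_tmul_mem _ (fun x => ?_) fun s => ?_
    · induction x using TensorProduct.induction_on with
      | zero => rw [TensorProduct.zero_tmul]; exact zero_mem _
      | tmul e a =>
        have h := Subalgebra.smul_mem _ (hmem (1 ⊗ₜ a)) e
        rw [hφA] at h
        change e • (((1 : E) ⊗ₜ[F] a) ⊗ₜ[E] (1 : S)) ∈ _ at h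
        rwa [TensorProduct.smul_tmul', TensorProduct.smul_tmul', smul_eq_mul, mul_one] at h
      | add x y hx hy => rw [TensorProduct.add_tmul]; exact add_mem hx hy
    · have hs : s ∈ Algebra.adjoin E {ψ θ, z} := hS ▸ Algebra.mem_top
      have hle : Algebra.adjoin E {ψ θ, z} ≤
          Subalgebra.comap ι (Algebra.adjoin E (insert (ι z) (Set.range φ))) := by
        refine Algebra.adjoin_le ?_
        rintro x (rfl | rfl)
        · exact Subalgebra.mem_comap _ _ _ |>.2 (hφK θ ▸ hmem (θ ⊗ₜ 1))
        · exact Algebra.subset_adjoin (Set.mem_insert _ _)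
      exact hle hs

theorem mainTheorem8 {F : Type*} [Field F] (p : ℕ) [Fact p.Prime] [CharP F p]
    {A : Type*} [Ring A] [Algebra F A] (hA : IsDivisionAlgebra F A) :
    (∀ (γ : F) (K : Type*) [Field K] [Algebra F K], IsCyclicArtinSchreier p γ K →
      IsDivisionAlgebra K (K ⊗[F] A) →
      IsDivisionAlgebra (RatFunc F)
        ((RatFunc F ⊗[F] A) ⊗[RatFunc F]
          SymbolAlgebra p (algebraMap F (RatFunc F) γ) (RatFunc.X : RatFunc F))) ∧
    (∀ (δ : F) (L : Type*) [Field L] [Algebra F L], IsPurelyInseparableRoot p δ L →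
      IsDivisionAlgebra L (L ⊗[F] A) →
      IsDivisionAlgebra (RatFunc F)
        ((RatFunc F ⊗[F] A) ⊗[RatFunc F]
          SymbolAlgebra p ((RatFunc.X : RatFunc F)⁻¹) (algebraMap F (RatFunc F) δ))) := by
  have hp := (Fact.out : p.Prime)
  have : CharP (RatFunc F) p :=
    charP_of_injective_algebraMap (algebraMap F (RatFunc F)).injective p
  refine ⟨fun γ K _ _ hK hKA => ?_, fun δ L _ _ hL hLA => ?_⟩
  · have : FiniteDimensional F K :=
      Module.finite_of_finrank_pos (hK.finrank_eq ▸ hp.pos)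
    generalize hα : algebraMap F (RatFunc F) γ = α
    set β := (RatFunc.X : RatFunc F)
    have := SymbolAlgebra.finite p α β hp.one_lt
    have := SymbolAlgebra.nontrivial p α β
    obtain ⟨θ, hθ, htop⟩ := hK.exists_generator
    obtain ⟨hadj, ψ, hψ⟩ := exists_algHom_apply_eq_of_natDegree_eq_finrank
      (w := SymbolAlgebra.u p α β) (monic_X_pow_sub_X_sub_C hp.one_lt γ)
      (by rw [natDegree_X_pow_sub_X_sub_C hp.one_lt, hK.finrank_eq]) (by simp [hθ]) htop
      (by
        simp only [map_sub, map_pow, Polynomial.aeval_X, Polynomial.aeval_C]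
        rw [SymbolAlgebra.u_pow_sub_u, IsScalarTower.algebraMap_apply F (RatFunc F), hα, sub_self])
    -- Automorphism type: `y u = (u + 1) y`, with `θ ↦ u` and `z = y`.
    refine isDivisionAlgebra_tensorProduct hA hKA ψ (SymbolAlgebra.y p α β) hadj
      (hψ ▸ SymbolAlgebra.adjoin_u_y p α β) ⟨θ + 1, 0, ?_⟩
      RatFunc.transcendental_X RatFunc.adjoin_X ?_
    · rw [map_add, map_one, hψ, SymbolAlgebra.y_mul_u, map_zero, add_zero]
    · rw [← SymbolAlgebra.y_pow]
      exact pow_mem (Algebra.self_mem_adjoin_singleton F _) p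
  · have : FiniteDimensional F L :=
      Module.finite_of_finrank_pos (hL.finrank_eq ▸ hp.pos)
    set α := (RatFunc.X : RatFunc F)⁻¹
    generalize hβ : algebraMap F (RatFunc F) δ = β
    have := SymbolAlgebra.finite p α β hp.one_lt
    have := SymbolAlgebra.nontrivial p α β
    obtain ⟨θ, hθ, htop⟩ := hL.exists_generator
    obtain ⟨hadj, ψ, hψ⟩ := exists_algHom_apply_eq_of_natDegree_eq_finrank
      (w := SymbolAlgebra.y p α β) (Polynomial.monic_X_pow_sub_C δ hp.ne_zero)
      (by rw [Polynomial.natDegree_X_pow_sub_C, hL.finrank_eq]) (by simp [hθ]) htop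
      (by
        simp only [map_sub, map_pow, Polynomial.aeval_X, Polynomial.aeval_C]
        rw [SymbolAlgebra.y_pow, IsScalarTower.algebraMap_apply F (RatFunc F), hβ, sub_self])
    -- Derivation type: `u y = y u - y`, with `θ ↦ y` and `z = u`. Here `t = x⁻¹`, which generates
    -- `F(x)` as well as `x` does.
    refine isDivisionAlgebra_tensorProduct hA hLA ψ (SymbolAlgebra.u p α β) hadj
      (by rw [hψ, Set.pair_comm]; exact SymbolAlgebra.adjoin_u_y p α β) ⟨θ, -θ, ?_⟩
      (t := α) ?_ ?_ ?_
    · rw [map_neg, hψ, ← sub_eq_add_neg, eq_sub_iff_add_eq, SymbolAlgebra.y_mul_u, add_mul, one_mul]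
    · exact fun h => RatFunc.transcendental_X (inv_inv (RatFunc.X : RatFunc F) ▸ h.inv)
    · rw [eq_top_iff, ← RatFunc.adjoin_X, IntermediateField.adjoin_simple_le_iff]
      exact inv_inv (RatFunc.X : RatFunc F) ▸
        inv_mem (IntermediateField.mem_adjoin_simple_self F α)
    · rw [← SymbolAlgebra.u_pow_sub_u]
      exact sub_mem (pow_mem (Algebra.self_mem_adjoin_singleton F _) p)
        (Algebra.self_mem_adjoin_singleton F _)
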